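/- A \emph{signed graph} $(G,\sigma)$ consists of a finite simple graph $G$ and a map $\sigma : E(G)\to\{+1,-1\}$; it is \emph{planar} if $G$ is, that is, if $G$ can be drawn in the Euclidean plane with distinct points as vertices and simple polygonal arcs as edges, each arc joining the two endvertices of its edge, such that the interior of an arc contains no vertex and no point of any other arc. A \emph{proper coloring} of $(G,\sigma)$ is a map $c : V(G)\to\mathbb{Z}$ with $c(u)\neq\sigma(uv)\,c(v)$ for every edge $uv\in E(G)$. \textbf{Corollary (Signed Five-Color Theorem).} Every planar signed graph $(G,\sigma)$ has a proper coloring with values in $\{-2,-1,0,1,2\}$. Hence its signed chromatic number \[ \chi(G,\sigma)=\min\{2k+1 : k\in\mathbb{Z}_{\ge 0},\ (G,\sigma)\text{ has a proper coloring with values in }\{-k,\dots,k\}\} \] is at most $5$; and so is the Máčajová–Raspaud–Škoviera signed chromatic number in its form without restriction to odd numbers, the smallest $n\ge 0$ such that $(G,\sigma)$ has a proper coloring with values in $M_n$, where $M_{2k}=\{\pm1,\dots,\pm k\}$ and $M_{2k+1}=\{0,\pm1,\dots,\pm k\}$. -/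

import Mathlib

/-- The Euclidean plane. -/
abbrev EuclPlane : Type := EuclideanSpace ℝ (Fin 2)

/-- `S` is a (polygonal) arc between `x` and `y`: a union of finitely many straight line segments
which is the image of the unit interval under a homeomorphism `γ` onto `S` (a continuous injection
of a compact space) with `γ 0 = x` and `γ 1 = y`. -/
def IsPlaneArc (S : Set EuclPlane) (x y : EuclPlane) : Prop :=
  (∃ F : Finset (EuclPlane × EuclPlane), S = ⋃ s ∈ F, segment ℝ s.1 s.2) ∧
    ∃ γ : unitInterval → EuclPlane, Continuous γ ∧ Function.Injective γ ∧
      γ 0 = x ∧ γ 1 = y ∧ Set.range γ = S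

/-- An embedding of a graph in the plane: vertices are distinct points, every edge is an arc between
its two endvertices, and the interior of an edge (the arc without its two endpoints)
contains no vertex and no point of any other edge. -/
structure PlaneEmbedding {V : Type*} (G : SimpleGraph V) where
  point : V → EuclPlane
  point_injective : Function.Injective point
  arc : G.edgeSet → Set EuclPlane
  isArc : ∀ (u v : V) (h : G.Adj u v), IsPlaneArc (arc ⟨s(u, v), h⟩) (point u) (point v)
  vertex_notMem_interior : ∀ (e : G.edgeSet) (w : V),
    point w ∉ arc e \ point '' {v | v ∈ (e : Sym2 V)}
  interior_disjoint : ∀ e f : G.edgeSet, e ≠ f →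
    Disjoint (arc e \ point '' {v | v ∈ (e : Sym2 V)}) (arc f)

/-- A signed graph `(G, σ)` with vertex set `V`: a simple graph `G` and a map
`σ : E(G) → {+1, -1}`. -/
structure SignedGraph (V : Type*) where
  graph : SimpleGraph V
  sign : graph.edgeSet → ℤˣ

namespace SignedGraph

/-- A signed graph is planar if its underlying graph embeds in the plane. -/
def IsPlanar {V : Type*} (S : SignedGraph V) : Prop :=
  Nonempty (PlaneEmbedding S.graph)

/-- `c` is a proper coloring: `c u ≠ σ(uv) c v` for every edge `uv`. -/
def IsProperColoring {V : Type*} (S : SignedGraph V) (c : V → ℤ) : Prop :=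
  ∀ (u v : V) (h : S.graph.Adj u v), c u ≠ (S.sign ⟨s(u, v), h⟩ : ℤ) * c v

/-- There is a proper coloring with all values in `P`. -/
def ColorableIn {V : Type*} (S : SignedGraph V) (P : Set ℤ) : Prop :=
  ∃ c : V → ℤ, S.IsProperColoring c ∧ ∀ v, c v ∈ P

/-- The symmetric palette `{-k, …, -1, 0, 1, …, k}`. -/
def symmPalette (k : ℕ) : Set ℤ := Set.Icc (-(k : ℤ)) k

/-- The smallest `2k + 1` such that there is a proper coloring in `{-k, …, k}`
(`⊤` if there is none). -/
noncomputable def chromaticNumber {V : Type*} (S : SignedGraph V) : ℕ∞ :=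
  ⨅ (k : ℕ) (_ : S.ColorableIn (symmPalette k)), ((2 * k + 1 : ℕ) : ℕ∞)

/-- The palette `M_n` with `n` elements: `{±1, …, ±k}` if `n = 2k`, and `{0, ±1, …, ±k}` if
`n = 2k + 1`. -/
def mrsPalette (n : ℕ) : Set ℤ := {x | 2 * |x| ≤ n ∧ (x = 0 → Odd n)}

/-- The smallest `n`, of either parity, such that there is a proper coloring in `M_n`
(`⊤` if there is none). -/
noncomputable def mrsChromaticNumber {V : Type*} (S : SignedGraph V) : ℕ∞ :=
  ⨅ (n : ℕ) (_ : S.ColorableIn (mrsPalette n)), (n : ℕ∞)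

end SignedGraph

/-! Thomassen's proof that planar graphs are 5-choosable survives signs, because a colored neighbour
`v` of `u` still forbids exactly one color at `u`, namely `σ(uv) c(v)`. The outer face is replaced
by a connected set `Z` of deleted vertices: the remaining vertices with a neighbour in `Z` act as
the boundary and need 3 colors, the others need 5, and a clique `X` of at most two boundary vertices
is precolored. The induction is `IsListInstance.exists_coloring`; deleting a boundary vertex moves
it into `Z`.

Planarity enters only through `SimpleGraph.SeparatesTriples`: a boundary vertex `p` with three
boundary neighbours yields an edge at `p` along which the instance can be split. Winding angles
prove this without the Jordan curve theorem. For each neighbour of `p`, take the closed curve that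
leaves `p` towards it, crosses `Z` and returns to `p` by one common edge. If no two neighbours were
separated, the angle of each curve would agree at points near `p` on the two other edges. Adding
these equalities and letting the points tend to `p`, three angles `arg (-(dᵢ / dⱼ))` add up to 0
(`angle_contradiction`); but the product of these three numbers is `-1`, so their sum is `π` modulo
`2π`. -/

open Filter Topology Finset

/-! ### Winding angles of curves in the complex plane. -/

/-- `θ x` is a total angle, seen from `x`, swept on the way from `u` to `v`; it is continuous for
`x` outside of `T`. -/
def IsAngleOff (T : Set ℂ) (u v : ℂ) (θ : ℂ → ℝ) : Prop :=
  ContinuousOn θ Tᶜ ∧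
    ∀ x ∉ T, (θ x : Real.Angle) = ((v - x).arg : Real.Angle) - ((u - x).arg : Real.Angle)

namespace IsAngleOff

theorem mono {S T : Set ℂ} {u v : ℂ} {θ : ℂ → ℝ} (h : IsAngleOff S u v θ) (hST : S ⊆ T) :
    IsAngleOff T u v θ :=
  ⟨h.1.mono (Set.compl_subset_compl.2 hST), fun x hx => h.2 x fun hx' => hx (hST hx')⟩

theorem add {T : Set ℂ} {u v w : ℂ} {θ η : ℂ → ℝ} (h : IsAngleOff T u v θ)
    (h' : IsAngleOff T v w η) : IsAngleOff T u w (fun x => θ x + η x) := by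
  refine ⟨h.1.add h'.1, fun x hx => ?_⟩
  rw [Real.Angle.coe_add, h.2 x hx, h'.2 x hx]
  abel

theorem const_zero (T : Set ℂ) (u : ℂ) : IsAngleOff T u u (fun _ => 0) :=
  ⟨continuousOn_const, fun x _ => by simp⟩

/-- The angle of a closed curve takes values in the discrete group of multiples of `2π`, so
continuity makes it constant on connected sets. -/
theorem eq_of_isPreconnected {T K : Set ℂ} {u : ℂ} {θ : ℂ → ℝ} (h : IsAngleOff T u u θ)
    (hK : IsPreconnected K) (hKT : Disjoint K T) {x y : ℂ} (hx : x ∈ K) (hy : y ∈ K) :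
    θ x = θ y := by
  have hsub : K ⊆ Tᶜ := hKT.subset_compl_right
  refine hK.constant_of_mapsTo (T := (AddSubgroup.zmultiples (2 * Real.pi) : Set ℝ)) (SetLike.isDiscrete_iff_discreteTopology.2 inferInstance)
    (h.1.mono hsub) ?_ hx hy
  intro z hz
  have := h.2 z (hsub hz)
  rw [sub_self, ← Real.Angle.coe_zero, Real.Angle.angle_eq_iff_two_pi_dvd_sub] at this
  obtain ⟨k, hk⟩ := this
  refine ⟨k, ?_⟩
  simp only [zsmul_eq_mul]
  linarith

end IsAngleOff

/-- The quotient `(v - x) / (u - x)` meets the branch cut of `arg` only when `x` lies between `u`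
and `v`. -/
theorem isAngleOff_segment (u v : ℂ) :
    IsAngleOff (segment ℝ u v) u v (fun x => ((v - x) / (u - x)).arg) := by
  have hne : ∀ x ∉ segment ℝ u v, u - x ≠ 0 ∧ v - x ≠ 0 := fun x hx =>
    ⟨fun h => hx (by rw [← sub_eq_zero.1 h]; exact left_mem_segment ℝ u v),
      fun h => hx (by rw [← sub_eq_zero.1 h]; exact right_mem_segment ℝ u v)⟩
  constructor
  · refine ContinuousOn.congr (f := Complex.arg ∘ fun x => (v - x) / (u - x)) ?_ fun _ _ => rfl
    intro x hx
    refine ContinuousAt.continuousWithinAt (ContinuousAt.comp ?_ ?_)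
    · apply Complex.continuousAt_arg
      by_contra hs
      rw [Complex.mem_slitPlane_iff_not_le_zero, not_not, Complex.le_def] at hs
      simp only [Complex.zero_re, Complex.zero_im] at hs
      obtain ⟨hre, him⟩ := hs
      set r := -((v - x) / (u - x)).re with hr
      have hr0 : 0 ≤ r := by linarith
      have hq : (v - x) / (u - x) = ((-r : ℝ) : ℂ) := by
        apply Complex.ext <;> simp [hr, him]
      rw [div_eq_iff (hne x hx).1] at hq
      apply hx
      have h1 : (1 + r) ≠ 0 := by positivity
      refine ⟨r / (1 + r), 1 / (1 + r), by positivity, by positivity, by field_simp; ring, ?_⟩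
      have h1' : (1 + r : ℂ) ≠ 0 := by exact_mod_cast h1
      have hv : v = x + r * (x - u) := by
        push_cast at hq
        linear_combination hq
      rw [Complex.real_smul, Complex.real_smul, hv]
      push_cast
      field_simp
      ring
    · exact (continuousAt_const.sub continuousAt_id).div (continuousAt_const.sub continuousAt_id)
        (hne x hx).1
  · intro x hx
    exact Complex.arg_div_coe_angle (hne x hx).2 (hne x hx).1

theorem exists_isAngleOff_of_reflTransGen {T : Set ℂ} {u v : ℂ}
    (h : Relation.ReflTransGen (fun a b => segment ℝ a b ⊆ T) u v) :
    ∃ θ, IsAngleOff T u v θ := by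
  induction h with
  | refl => exact ⟨_, IsAngleOff.const_zero T u⟩
  | tail _ hbc ih =>
    obtain ⟨θ, hθ⟩ := ih
    exact ⟨_, hθ.add ((isAngleOff_segment _ _).mono hbc)⟩

/-- Three curves that leave `p` in distinct directions cannot be pairwise balanced. -/
theorem angle_contradiction {p d₁ d₂ d₃ : ℂ}
    (h₁₂ : -(d₁ / d₂) ∈ Complex.slitPlane) (h₂₃ : -(d₂ / d₃) ∈ Complex.slitPlane)
    (h₃₁ : -(d₃ / d₁) ∈ Complex.slitPlane) {ψ₁ ψ₂ ψ₃ q : ℂ → ℝ}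
    (hψ₁ : ContinuousAt ψ₁ p) (hψ₂ : ContinuousAt ψ₂ p) (hψ₃ : ContinuousAt ψ₃ p)
    {Θ : ℂ → (ℂ → ℝ) → ℂ → ℝ}
    (hΘ : ∀ d ψ x, Θ d ψ x = ((p + d - x) / (p - x)).arg + ψ x + q x)
    (e₁ : ∀ ε : ℝ, 0 < ε → ε ≤ 1 → Θ d₁ ψ₁ (p + ε * d₃) = Θ d₁ ψ₁ (p + ε * d₂))
    (e₂ : ∀ ε : ℝ, 0 < ε → ε ≤ 1 → Θ d₂ ψ₂ (p + ε * d₁) = Θ d₂ ψ₂ (p + ε * d₃))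
    (e₃ : ∀ ε : ℝ, 0 < ε → ε ≤ 1 → Θ d₃ ψ₃ (p + ε * d₂) = Θ d₃ ψ₃ (p + ε * d₁)) : False := by
  have ne : ∀ {d e : ℂ}, -(d / e) ∈ Complex.slitPlane → d ≠ 0 ∧ e ≠ 0 := by
    intro d e h
    have := Complex.slitPlane_ne_zero h
    rw [neg_ne_zero, div_ne_zero_iff] at this
    exact this
  have n₁ := (ne h₁₂).1
  have n₂ := (ne h₁₂).2
  have n₃ := (ne h₂₃).2
  have inv : ∀ {d e : ℂ}, -(d / e) ∈ Complex.slitPlane →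
      -(e / d) ∈ Complex.slitPlane ∧ (-(e / d)).arg = -(-(d / e)).arg := by
    intro d e h
    have h2 : -(e / d) = (-(d / e))⁻¹ := by rw [inv_neg, inv_div]
    rw [h2]
    refine ⟨?_, ?_⟩
    · rw [Complex.mem_slitPlane_iff_arg] at h ⊢
      rw [Complex.arg_inv, if_neg h.1]
      have := Complex.neg_pi_lt_arg (-(d / e))
      exact ⟨by intro h'; linarith, inv_ne_zero h.2⟩
    · rw [Complex.arg_inv, if_neg (Complex.mem_slitPlane_iff_arg.1 h).1]
  -- Multiplying the quotient by `ε > 0` keeps its argument and removes the singularity at `ε = 0`.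
  have scale : ∀ (d e : ℂ) (ε : ℝ), e ≠ 0 → 0 < ε →
      ((p + d - (p + ε * e)) / (p - (p + ε * e))).arg = (-(d / e) + ε).arg := by
    intro d e ε he hε
    rw [← Complex.arg_real_mul (x := (p + d - (p + ε * e)) / (p - (p + ε * e))) hε]
    congr 1
    have : (ε : ℂ) ≠ 0 := by exact_mod_cast hε.ne'
    have h3 : p - (p + ε * e) = -(ε * e) := by ring
    rw [h3]
    field_simp
    ring
  have lim : ∀ {d e : ℂ}, -(d / e) ∈ Complex.slitPlane →
      Tendsto (fun ε : ℝ => (-(d / e) + ε).arg) (𝓝[>] 0) (𝓝 (-(d / e)).arg) := by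
    intro d e h
    have hc : ContinuousAt (fun ε : ℝ => (-(d / e) + (ε : ℂ)).arg) 0 := by
      refine ContinuousAt.comp (g := Complex.arg) ?_ (by fun_prop)
      apply Complex.continuousAt_arg
      simpa using h
    have := hc.tendsto.mono_left (nhdsWithin_le_nhds (s := Set.Ioi 0))
    simpa using this
  have limψ : ∀ {ψ : ℂ → ℝ} (d : ℂ), ContinuousAt ψ p →
      Tendsto (fun ε : ℝ => ψ (p + ε * d)) (𝓝[>] 0) (𝓝 (ψ p)) := by
    intro ψ d h
    have hc : ContinuousAt (fun ε : ℝ => ψ (p + ε * d)) 0 := by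
      refine ContinuousAt.comp (g := ψ) ?_ (by fun_prop)
      simpa using h
    have := hc.tendsto.mono_left (nhdsWithin_le_nhds (s := Set.Ioi 0))
    simpa using this
  -- This is the sum of the differences of the two sides in `e₁`, `e₂`, `e₃`. The common term `q`,
  -- which need not be continuous at `p`, has cancelled.
  have key : Tendsto (fun ε : ℝ =>
      ((-(d₁ / d₃) + ε).arg - (-(d₁ / d₂) + ε).arg + (ψ₁ (p + ε * d₃) - ψ₁ (p + ε * d₂))) +
      ((-(d₂ / d₁) + ε).arg - (-(d₂ / d₃) + ε).arg + (ψ₂ (p + ε * d₁) - ψ₂ (p + ε * d₃))) +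
      ((-(d₃ / d₂) + ε).arg - (-(d₃ / d₁) + ε).arg + (ψ₃ (p + ε * d₂) - ψ₃ (p + ε * d₁))))
      (𝓝[>] 0) (𝓝 (((-(d₁ / d₃)).arg - (-(d₁ / d₂)).arg + (ψ₁ p - ψ₁ p)) +
      ((-(d₂ / d₁)).arg - (-(d₂ / d₃)).arg + (ψ₂ p - ψ₂ p)) +
      ((-(d₃ / d₂)).arg - (-(d₃ / d₁)).arg + (ψ₃ p - ψ₃ p)))) := by
    refine ((Tendsto.add ?_ ?_).add (Tendsto.add ?_ ?_)).add (Tendsto.add ?_ ?_)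
    · exact (lim (inv h₃₁).1).sub (lim h₁₂)
    · exact (limψ _ hψ₁).sub (limψ _ hψ₁)
    · exact (lim (inv h₁₂).1).sub (lim h₂₃)
    · exact (limψ _ hψ₂).sub (limψ _ hψ₂)
    · exact (lim (inv h₂₃).1).sub (lim h₃₁)
    · exact (limψ _ hψ₃).sub (limψ _ hψ₃)
  have zero := key.congr' (f₂ := fun _ => (0 : ℝ)) (by
    filter_upwards [Ioc_mem_nhdsGT (zero_lt_one (α := ℝ))] with ε hε
    have e₁ := e₁ ε hε.1 hε.2
    have e₂ := e₂ ε hε.1 hε.2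
    have e₃ := e₃ ε hε.1 hε.2
    simp only [hΘ] at e₁ e₂ e₃
    rw [scale _ _ _ n₃ hε.1, scale _ _ _ n₂ hε.1] at e₁
    rw [scale _ _ _ n₁ hε.1, scale _ _ _ n₃ hε.1] at e₂
    rw [scale _ _ _ n₂ hε.1, scale _ _ _ n₁ hε.1] at e₃
    linarith)
  have hsum := tendsto_nhds_unique zero tendsto_const_nhds
  rw [(inv h₃₁).2, (inv h₁₂).2, (inv h₂₃).2] at hsum
  have hs0 : (-(d₁ / d₂)).arg + (-(d₂ / d₃)).arg + (-(d₃ / d₁)).arg = 0 := by linarith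
  have hang : (((-(d₁ / d₂)).arg + (-(d₂ / d₃)).arg + (-(d₃ / d₁)).arg : ℝ) : Real.Angle) =
      Real.pi := by
    rw [Real.Angle.coe_add, Real.Angle.coe_add,
      ← Complex.arg_mul_coe_angle (Complex.slitPlane_ne_zero h₁₂) (Complex.slitPlane_ne_zero h₂₃),
      ← Complex.arg_mul_coe_angle (mul_ne_zero (Complex.slitPlane_ne_zero h₁₂)
        (Complex.slitPlane_ne_zero h₂₃)) (Complex.slitPlane_ne_zero h₃₁)]
    have : -(d₁ / d₂) * -(d₂ / d₃) * -(d₃ / d₁) = -1 := by field_simp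
    rw [this, Complex.arg_neg_one]
  rw [hs0, Real.Angle.coe_zero] at hang
  exact Real.Angle.pi_ne_zero hang.symm

/-! ### Local straightness of polygonal arcs. -/

/-- `S` is a polygonal arc in the complex plane with ends `u` and `v`. -/
def IsComplexArc (S : Set ℂ) (u v : ℂ) : Prop :=
  (∃ F : Finset (ℂ × ℂ), S = ⋃ s ∈ F, segment ℝ s.1 s.2) ∧
    ∃ g : ℝ → ℂ, Continuous g ∧ Set.InjOn g (Set.Icc 0 1) ∧ g 0 = u ∧ g 1 = v ∧
      g '' Set.Icc 0 1 = S

theorem exists_eq_real_mul_of_mem_segment {a b y p : ℂ} (hy : y ∈ segment ℝ a b)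
    (hp : p ∈ segment ℝ a b) : ∃ k : ℝ, y - p = k * (b - a) := by
  rw [segment_eq_image_lineMap] at hy hp
  obtain ⟨s, -, rfl⟩ := hy
  obtain ⟨t, -, rfl⟩ := hp
  refine ⟨s - t, ?_⟩
  simp only [AffineMap.lineMap_apply, vsub_eq_sub, vadd_eq_add, Complex.real_smul]
  push_cast
  ring

/-- A finite union of segments has only finitely many directions at each point. -/
theorem exists_finite_directions (F : Finset (ℂ × ℂ)) (p : ℂ) :
    ∃ D : Set ℂ, D.Finite ∧ ∀ᶠ y in 𝓝 p, (∃ s ∈ F, y ∈ segment ℝ s.1 s.2) → y ≠ p →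
      (y - p) / (‖y - p‖ : ℂ) ∈ D := by
  let dir : ℂ × ℂ → ℂ := fun s => (s.2 - s.1) / (‖s.2 - s.1‖ : ℂ)
  refine ⟨(dir '' F) ∪ ((fun s => -dir s) '' F),
    (F.finite_toSet.image _).union (F.finite_toSet.image _), ?_⟩
  -- Segments are closed, so near `p` only those through `p` matter, and each contributes at most
  -- two opposite directions.
  have hev : ∀ᶠ y in 𝓝 p, ∀ s ∈ F, y ∈ segment ℝ s.1 s.2 → p ∈ segment ℝ s.1 s.2 := by
    rw [eventually_all_finset]
    intro s _
    by_cases hp : p ∈ segment ℝ s.1 s.2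
    · exact Eventually.of_forall fun _ _ => hp
    · have hc : IsClosed (segment ℝ s.1 s.2) := by
        rw [segment_eq_image_lineMap]
        exact (isCompact_Icc.image (AffineMap.lineMap_continuous)).isClosed
      filter_upwards [hc.isOpen_compl.mem_nhds hp] with y hy hy'
      exact absurd hy' hy
  filter_upwards [hev] with y hy hex hne
  obtain ⟨s, hs, hys⟩ := hex
  obtain ⟨k, hk⟩ := exists_eq_real_mul_of_mem_segment hys (hy s hs hys)
  have hyp : y - p ≠ 0 := sub_ne_zero.2 hne
  have hk0 : k ≠ 0 := by
    rintro rfl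
    simp at hk
    exact hyp hk
  have hn : (‖y - p‖ : ℂ) = |k| * ‖s.2 - s.1‖ := by
    rw [hk, norm_mul, Complex.norm_real, Real.norm_eq_abs]
    push_cast
    rfl
  rcases lt_or_gt_of_ne hk0 with h | h
  · refine Or.inr ⟨s, hs, ?_⟩
    simp only [dir]
    rw [hn, hk, abs_of_neg h]
    have : (k : ℂ) ≠ 0 := by exact_mod_cast hk0
    push_cast
    rw [neg_mul, div_neg, mul_div_mul_left _ _ this]
  · refine Or.inl ⟨s, hs, ?_⟩
    simp only [dir]
    rw [hn, hk, abs_of_pos h]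
    have : (k : ℂ) ≠ 0 := by exact_mod_cast hk0
    rw [mul_div_mul_left _ _ this]

/-- The curve stays on one ray from `g s`, where a point is determined by its distance from `g s`;
the intermediate value theorem supplies every distance. -/
theorem segment_subset_image_of_direction_const {g : ℝ → ℂ} (hg : Continuous g) {s t : ℝ} {e : ℂ}
    (h : ∀ r ∈ Set.uIcc s t, g r - g s = ‖g r - g s‖ * e) :
    segment ℝ (g s) (g t) ⊆ g '' Set.uIcc s t := by
  intro x hx
  rw [segment_eq_image_lineMap] at hx
  obtain ⟨c, hc, rfl⟩ := hx
  have hcont : ContinuousOn (fun r => ‖g r - g s‖) (Set.uIcc s t) := by fun_prop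
  have hmem : c * ‖g t - g s‖ ∈ Set.uIcc ‖g s - g s‖ ‖g t - g s‖ := by
    rw [sub_self, norm_zero, Set.uIcc_of_le (norm_nonneg _)]
    exact ⟨by have := hc.1; positivity, mul_le_of_le_one_left (norm_nonneg _) hc.2⟩
  obtain ⟨r, hr, hrc⟩ := intermediate_value_uIcc hcont hmem
  refine ⟨r, hr, ?_⟩
  have h1 := h r hr
  have h2 := h t Set.right_mem_uIcc
  simp only at hrc
  rw [hrc] at h1
  simp only [AffineMap.lineMap_apply, vsub_eq_sub, vadd_eq_add, Complex.real_smul]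
  push_cast at h1
  linear_combination h1 - c * h2

theorem isPreconnected_uIcc_sdiff_left (s t : ℝ) : IsPreconnected (Set.uIcc s t \ {s}) := by
  rcases le_total s t with h | h
  · rw [Set.uIcc_of_le h, Set.Icc_sdiff_left]
    exact isPreconnected_Ioc
  · rw [Set.uIcc_of_ge h, Set.Icc_sdiff_right]
    exact isPreconnected_Ico

namespace IsComplexArc

/-- A polygonal arc is straight near each of its points, on either side. -/
theorem eventually_segment_subset {F : Finset (ℂ × ℂ)} {g : ℝ → ℂ} (hg : Continuous g)
    (hinj : Set.InjOn g (Set.Icc 0 1)) (hF : g '' Set.Icc 0 1 = ⋃ s ∈ F, segment ℝ s.1 s.2)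
    {s : ℝ} (hs : s ∈ Set.Icc (0 : ℝ) 1) :
    ∀ᶠ t in 𝓝 s, t ∈ Set.Icc (0 : ℝ) 1 → segment ℝ (g s) (g t) ⊆ g '' Set.uIcc s t := by
  obtain ⟨D, hD, hev⟩ := exists_finite_directions F (g s)
  obtain ⟨ε, hε, hball⟩ := Metric.eventually_nhds_iff.1 (hg.continuousAt.eventually hev)
  filter_upwards [Metric.ball_mem_nhds s hε] with t ht ht1
  rcases eq_or_ne t s with rfl | hts
  · simp
  have hsub : Set.uIcc s t ⊆ Set.Icc 0 1 := Set.uIcc_subset_Icc hs ht1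
  -- The direction from `g s` is continuous on a connected set and takes values in the finite set
  -- `D`, hence is constant.
  have hdir : Set.MapsTo (fun r => (g r - g s) / (‖g r - g s‖ : ℂ)) (Set.uIcc s t \ {s}) D := by
    intro r hr
    have hrI := hsub hr.1
    refine hball ?_ ?_ ?_
    · rw [Real.dist_eq]
      refine lt_of_le_of_lt ?_ (Real.dist_eq t s ▸ Metric.mem_ball.1 ht)
      exact Set.abs_sub_left_of_mem_uIcc hr.1
    · have : g r ∈ g '' Set.Icc 0 1 := ⟨r, hrI, rfl⟩
      rw [hF] at this
      simpa using this
    · exact fun h => hr.2 (hinj hrI hs h)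
  have hne : ∀ r ∈ Set.uIcc s t \ {s}, (‖g r - g s‖ : ℂ) ≠ 0 := by
    intro r hr
    have : g r ≠ g s := fun h => hr.2 (hinj (hsub hr.1) hs h)
    simpa [sub_eq_zero] using this
  have hcont : ContinuousOn (fun r => (g r - g s) / (‖g r - g s‖ : ℂ)) (Set.uIcc s t \ {s}) := by
    refine ContinuousOn.div (by fun_prop) ?_ hne
    fun_prop
  have htm : t ∈ Set.uIcc s t \ {s} := ⟨Set.right_mem_uIcc, hts⟩
  refine segment_subset_image_of_direction_const hg (e := (g t - g s) / (‖g t - g s‖ : ℂ)) ?_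
  intro r hr
  rcases eq_or_ne r s with rfl | hrs
  · simp
  have hrm : r ∈ Set.uIcc s t \ {s} := ⟨hr, hrs⟩
  have := (isPreconnected_uIcc_sdiff_left s t).constant_of_mapsTo hD.isDiscrete hcont hdir hrm htm
  rw [← this, mul_div_cancel₀ _ (hne r hrm)]

theorem isPreconnected_diff {S : Set ℂ} {u v : ℂ} (h : IsComplexArc S u v) :
    IsPreconnected (S \ {u}) := by
  obtain ⟨-, g, hg, hinj, rfl, -, rfl⟩ := h
  have : g '' Set.Icc 0 1 \ {g 0} = g '' Set.Ioc 0 1 := by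
    rw [← Set.Icc_sdiff_left, hinj.image_sdiff]
    congr 1
    have : Set.Icc (0 : ℝ) 1 ∩ {0} = {0} := by simp
    rw [this, Set.image_singleton]
  rw [this]
  exact isPreconnected_Ioc.image _ hg.continuousOn

theorem isClosed {S : Set ℂ} {u v : ℂ} (h : IsComplexArc S u v) : IsClosed S := by
  obtain ⟨-, g, hg, -, -, -, rfl⟩ := h
  exact (isCompact_Icc.image hg).isClosed

theorem left_mem {S : Set ℂ} {u v : ℂ} (h : IsComplexArc S u v) : u ∈ S := by
  obtain ⟨-, g, hg, -, rfl, -, rfl⟩ := h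
  exact ⟨0, by simp, rfl⟩

theorem right_mem {S : Set ℂ} {u v : ℂ} (h : IsComplexArc S u v) : v ∈ S := by
  obtain ⟨-, g, hg, -, -, rfl, rfl⟩ := h
  exact ⟨1, by simp, rfl⟩

/-- A polygonal arc starts with a segment, followed by a closed part that avoids the start. -/
theorem exists_initial_segment {S : Set ℂ} {u v : ℂ} (h : IsComplexArc S u v) :
    ∃ d : ℂ, d ≠ 0 ∧ segment ℝ u (u + d) ⊆ S ∧ ∃ T ⊆ S, IsClosed T ∧ u ∉ T ∧
      ∃ θ, IsAngleOff T (u + d) v θ := by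
  obtain ⟨⟨F, hF⟩, g, hg, hinj, rfl, rfl, rfl⟩ := h
  have h0 : (0 : ℝ) ∈ Set.Icc (0 : ℝ) 1 := by simp
  obtain ⟨δ, hδ, hδI⟩ := (((eventually_segment_subset hg hinj hF h0).filter_mono
    nhdsWithin_le_nhds).and (Ioc_mem_nhdsGT (zero_lt_one (α := ℝ)))).exists
  have hδ' : δ ∈ Set.Icc (0 : ℝ) 1 := ⟨hδI.1.le, hδI.2⟩
  refine ⟨g δ - g 0, sub_ne_zero.2 fun h => hδI.1.ne' (hinj hδ' h0 h), ?_, g '' Set.Icc δ 1,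
    Set.image_mono (Set.Icc_subset_Icc_left hδI.1.le), (isCompact_Icc.image hg).isClosed, ?_, ?_⟩
  · rw [add_sub_cancel]
    exact (hδ hδ').trans (Set.image_mono (Set.uIcc_subset_Icc h0 hδ'))
  · rintro ⟨t, ht, ht0⟩
    have := hinj ⟨hδI.1.le.trans ht.1, ht.2⟩ h0 ht0
    rw [this] at ht
    exact absurd ht.1 (not_le.2 hδI.1)
  · rw [add_sub_cancel]
    apply exists_isAngleOff_of_reflTransGen
    -- Local straightness and connectedness of `[δ, 1]` give a finite chain of segments inside the
    -- rest of the arc.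
    refine (isPreconnected_Icc (a := δ) (b := 1)).induction₂
      (fun s t => Relation.ReflTransGen (fun a b => segment ℝ a b ⊆ g '' Set.Icc δ 1) (g s) (g t))
      ?_ (fun _ _ _ _ _ _ h h' => h.trans h') ?_ (Set.left_mem_Icc.2 hδI.2)
      (Set.right_mem_Icc.2 hδI.2)
    · intro s hs
      have hs' : s ∈ Set.Icc (0 : ℝ) 1 := ⟨hδI.1.le.trans hs.1, hs.2⟩
      filter_upwards [nhdsWithin_le_nhds (eventually_segment_subset hg hinj hF hs'),
        self_mem_nhdsWithin] with t ht htI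
      exact .single ((ht ⟨hδI.1.le.trans htI.1, htI.2⟩).trans
        (Set.image_mono (Set.uIcc_subset_Icc hs htI)))
    · intro s t _ _ hst
      have : Std.Symm (fun a b => segment ℝ a b ⊆ g '' Set.Icc δ 1) :=
        ⟨fun a b hab => by rwa [segment_symm]⟩
      exact symm hst

theorem exists_isAngleOff {S : Set ℂ} {u v : ℂ} (h : IsComplexArc S u v) :
    ∃ θ, IsAngleOff S u v θ := by
  obtain ⟨d, -, hseg, T, hTS, -, -, θ, hθ⟩ := h.exists_initial_segment
  exact ⟨_, ((isAngleOff_segment _ _).mono hseg).add (hθ.mono hTS)⟩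

end IsComplexArc

/-! ### Plane embeddings and the separation of triples. -/

/-- The standard identification of the Euclidean plane with the complex plane. -/
noncomputable def planeEquiv : EuclPlane ≃ₗᵢ[ℝ] ℂ := Complex.orthonormalBasisOneI.repr.symm

theorem IsPlaneArc.isComplexArc {S : Set EuclPlane} {x y : EuclPlane} (h : IsPlaneArc S x y) :
    IsComplexArc (planeEquiv '' S) (planeEquiv x) (planeEquiv y) := by
  classical
  obtain ⟨⟨F, hF⟩, γ, hγ, hinj, rfl, rfl, hS⟩ := h
  constructor
  · refine ⟨F.image (fun s => (planeEquiv s.1, planeEquiv s.2)), ?_⟩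
    rw [hF, Set.image_iUnion₂, Finset.set_biUnion_finset_image]
    refine Set.iUnion₂_congr fun s _ => ?_
    exact image_segment ℝ (planeEquiv.toLinearEquiv.toLinearMap.toAffineMap) s.1 s.2
  · refine ⟨fun t => planeEquiv (γ (Set.projIcc 0 1 zero_le_one t)), ?_, ?_, ?_, ?_, ?_⟩
    · exact planeEquiv.continuous.comp (hγ.comp continuous_projIcc)
    · intro s hs t ht hst
      have := hinj (planeEquiv.injective hst)
      rw [Set.projIcc_of_mem zero_le_one hs, Set.projIcc_of_mem zero_le_one ht] at this
      exact congrArg Subtype.val this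
    · simp
    · simp
    · rw [← hS, ← Set.range_comp]
      ext z
      constructor
      · rintro ⟨t, -, rfl⟩
        exact ⟨_, rfl⟩
      · rintro ⟨t, rfl⟩
        exact ⟨t, t.2, by simp⟩

/-- `u` and `v` are joined by a walk whose edges have both ends in `S`. -/
def SimpleGraph.LinkedIn {V : Type*} (G : SimpleGraph V) (S : Set V) (u v : V) : Prop :=
  Relation.ReflTransGen (fun x y => G.Adj x y ∧ x ∈ S ∧ y ∈ S) u v

namespace SimpleGraph.LinkedIn

variable {V : Type*} {G : SimpleGraph V} {S T : Set V} {u v w : V}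

theorem mono (h : G.LinkedIn S u v) (hST : S ⊆ T) : G.LinkedIn T u v :=
  Relation.ReflTransGen.mono (fun _ _ h => ⟨h.1, hST h.2.1, hST h.2.2⟩) _ _ h

theorem symm (h : G.LinkedIn S u v) : G.LinkedIn S v u := by
  have : Std.Symm (fun x y => G.Adj x y ∧ x ∈ S ∧ y ∈ S) :=
    ⟨fun _ _ h => ⟨h.1.symm, h.2.2, h.2.1⟩⟩
  exact _root_.symm (r := Relation.ReflTransGen fun x y => G.Adj x y ∧ x ∈ S ∧ y ∈ S) h

theorem of_adj (h : G.Adj u v) (hu : u ∈ S) (hv : v ∈ S) : G.LinkedIn S u v :=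
  .single ⟨h, hu, hv⟩

theorem trans (h : G.LinkedIn S u v) (h' : G.LinkedIn S v w) : G.LinkedIn S u w :=
  Relation.ReflTransGen.trans h h'

end SimpleGraph.LinkedIn

theorem IsComplexArc.isPreconnected {S : Set ℂ} {u v : ℂ} (h : IsComplexArc S u v) :
    IsPreconnected S := by
  obtain ⟨-, g, hg, -, -, -, rfl⟩ := h
  exact isPreconnected_Icc.image _ hg.continuousOn

namespace PlaneEmbedding

variable {V : Type*} {G : SimpleGraph V} (E : PlaneEmbedding G)

/-- The position of a vertex in the complex plane. -/
noncomputable def pt (v : V) : ℂ := planeEquiv (E.point v)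

/-- The arc in the complex plane of an edge; empty for a pair that is not an edge. -/
def edgeArc (e : Sym2 V) : Set ℂ := {x | ∃ h : e ∈ G.edgeSet, x ∈ planeEquiv '' E.arc ⟨e, h⟩}

/-- The part of the complex plane covered by the edges with both ends in `S`. -/
def drawing (S : Set V) : Set ℂ := {x | ∃ e : Sym2 V, (∀ w ∈ e, w ∈ S) ∧ x ∈ E.edgeArc e}

theorem edgeArc_eq {e : Sym2 V} (h : e ∈ G.edgeSet) :
    E.edgeArc e = planeEquiv '' E.arc ⟨e, h⟩ := by
  ext x
  exact ⟨fun ⟨_, hx⟩ => hx, fun hx => ⟨h, hx⟩⟩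

theorem isComplexArc {u v : V} (h : G.Adj u v) :
    IsComplexArc (E.edgeArc s(u, v)) (E.pt u) (E.pt v) := by
  rw [E.edgeArc_eq (G.mem_edgeSet.2 h)]
  exact (E.isArc u v h).isComplexArc

theorem mem_of_pt_mem_edgeArc {e : Sym2 V} {w : V} (h : E.pt w ∈ E.edgeArc e) : w ∈ e := by
  obtain ⟨he, y, hy, hyw⟩ := h
  have hyw := planeEquiv.injective hyw
  subst hyw
  by_contra hw
  refine E.vertex_notMem_interior ⟨e, he⟩ w ⟨hy, ?_⟩
  rintro ⟨v, hv, hvw⟩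
  exact hw (E.point_injective hvw ▸ hv)

theorem exists_common_end {e f : Sym2 V} (hef : e ≠ f) {x : ℂ} (hx : x ∈ E.edgeArc e)
    (hx' : x ∈ E.edgeArc f) : ∃ w ∈ e, w ∈ f ∧ x = E.pt w := by
  obtain ⟨he, y, hy, rfl⟩ := hx
  obtain ⟨hf, y', hy', hyy⟩ := hx'
  rw [planeEquiv.injective hyy] at hy'
  have hdis := E.interior_disjoint ⟨e, he⟩ ⟨f, hf⟩ fun h => hef (congrArg Subtype.val h)
  by_cases hyV : y ∈ E.point '' {v | v ∈ e}
  · obtain ⟨w, hw, rfl⟩ := hyV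
    exact ⟨w, hw, E.mem_of_pt_mem_edgeArc ⟨hf, _, hy', rfl⟩, rfl⟩
  · exact (Set.disjoint_left.1 hdis ⟨hy, hyV⟩ hy').elim

theorem pt_notMem_drawing {S : Set V} {w : V} (h : w ∉ S) : E.pt w ∉ E.drawing S := by
  rintro ⟨e, he, hwe⟩
  exact h (he w (E.mem_of_pt_mem_edgeArc hwe))

theorem edgeArc_subset_drawing {S : Set V} {u v : V} (hu : u ∈ S) (hv : v ∈ S) :
    E.edgeArc s(u, v) ⊆ E.drawing S := by
  intro x hx
  refine ⟨_, ?_, hx⟩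
  rintro w hw
  rcases Sym2.mem_iff.1 hw with rfl | rfl <;> assumption

theorem drawing_mono {S T : Set V} (h : S ⊆ T) : E.drawing S ⊆ E.drawing T := by
  rintro x ⟨e, he, hx⟩
  exact ⟨e, fun w hw => h (he w hw), hx⟩

theorem isClosed_edgeArc (e : Sym2 V) : IsClosed (E.edgeArc e) := by
  by_cases he : e ∈ G.edgeSet
  · induction e with
    | h u v => exact (E.isComplexArc (G.mem_edgeSet.1 he)).isClosed
  · have : E.edgeArc e = ∅ := Set.eq_empty_of_forall_notMem fun x ⟨h, _⟩ => he h
    rw [this]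
    exact isClosed_empty

theorem isClosed_drawing [Finite V] (S : Set V) : IsClosed (E.drawing S) := by
  have : E.drawing S = ⋃ e ∈ {e : Sym2 V | ∀ w ∈ e, w ∈ S}, E.edgeArc e := by
    ext x
    simp [drawing]
  rw [this]
  exact (Set.toFinite _).isClosed_biUnion fun e _ => E.isClosed_edgeArc e

theorem exists_isAngleOff_of_linkedIn {S : Set V} {u v : V} (h : G.LinkedIn S u v) :
    ∃ θ, IsAngleOff (E.drawing S) (E.pt u) (E.pt v) θ := by
  induction h with
  | refl => exact ⟨_, IsAngleOff.const_zero _ _⟩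
  | tail _ hbc ih =>
    obtain ⟨θ, hθ⟩ := ih
    obtain ⟨η, hη⟩ := (E.isComplexArc hbc.1).exists_isAngleOff
    exact ⟨_, hθ.add (hη.mono (E.edgeArc_subset_drawing hbc.2.1 hbc.2.2))⟩

theorem edgeArc_diff_disjoint_drawing {S : Set V} {p c : V} (hc : c ∉ S) :
    Disjoint (E.edgeArc s(p, c) \ {E.pt p}) (E.drawing S) := by
  rw [Set.disjoint_left]
  rintro z ⟨hz, hzp⟩ ⟨e, he, hze⟩
  have hne : s(p, c) ≠ e := by
    rintro rfl
    exact hc (he c (Sym2.mem_mk_right p c))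
  obtain ⟨w, hw, hwe, rfl⟩ := E.exists_common_end hne hz hze
  rcases Sym2.mem_iff.1 hw with rfl | rfl
  · exact hzp rfl
  · exact hc (he _ hwe)

theorem edgeArc_disjoint_drawing {S : Set V} {p c : V} (hp : p ∉ S) (hc : c ∉ S) :
    Disjoint (E.edgeArc s(p, c)) (E.drawing S) := by
  rw [Set.disjoint_left]
  intro z hz hzS
  by_cases h : z = E.pt p
  · exact E.pt_notMem_drawing hp (h ▸ hzS)
  · exact Set.disjoint_left.1 (E.edgeArc_diff_disjoint_drawing hc) ⟨hz, h⟩ hzS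

/-- A total angle along a closed curve in `drawing S` is the same from all points that are joined
without meeting `drawing S`. -/
theorem angle_eq_of_linkedIn {S R : Set V} (hRS : Disjoint R S) {p b c : V} (hb : b ∈ R)
    (hc : c ∈ R) (hpb : G.Adj p b) (hpc : G.Adj p c) (h : G.LinkedIn R b c) {u : ℂ} {θ : ℂ → ℝ}
    (hθ : IsAngleOff (E.drawing S) u u θ) {x y : ℂ} (hx : x ∈ E.edgeArc s(p, b) \ {E.pt p})
    (hy : y ∈ E.edgeArc s(p, c) \ {E.pt p}) : θ x = θ y := by
  have hR : ∀ {w}, w ∈ R → w ∉ S := fun hw => Set.disjoint_left.1 hRS hw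
  -- Without `p`, the edge `pw` is connected and avoids the drawing of `S`, so the point may slide
  -- to `w`.
  have toEnd : ∀ {w z}, w ∈ R → G.Adj p w → z ∈ E.edgeArc s(p, w) \ {E.pt p} →
      θ z = θ (E.pt w) := by
    intro w z hw hpw hz
    refine hθ.eq_of_isPreconnected (E.isComplexArc hpw).isPreconnected_diff
      (E.edgeArc_diff_disjoint_drawing (hR hw)) hz ⟨(E.isComplexArc hpw).right_mem, ?_⟩
    intro h
    exact hpw.ne' (E.point_injective (planeEquiv.injective h))
  rw [toEnd hb hpb hx, toEnd hc hpc hy]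
  clear hx hy hc hpc
  induction h with
  | refl => rfl
  | tail _ hcd ih =>
    rw [ih]
    exact hθ.eq_of_isPreconnected (E.isComplexArc hcd.1).isPreconnected
      (E.edgeArc_disjoint_drawing (hR hcd.2.1) (hR hcd.2.2)) (E.isComplexArc hcd.1).left_mem
      (E.isComplexArc hcd.1).right_mem

/-- The closed curve from `p` along the edge `pa`, through `Z` to `z₀`, and back to `p`. -/
theorem exists_closed_angle [Finite V] {Z : Set V} {p a z z₀ : V}
    (hZ : ∀ u ∈ Z, ∀ v ∈ Z, G.LinkedIn Z u v) (hp : p ∉ Z) (hpa : G.Adj p a) (hz : z ∈ Z)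
    (haz : G.Adj a z) (hz₀ : z₀ ∈ Z) {q : ℂ → ℝ}
    (hq : IsAngleOff (E.edgeArc s(z₀, p)) (E.pt z₀) (E.pt p) q) :
    ∃ d : ℂ, d ≠ 0 ∧ segment ℝ (E.pt p) (E.pt p + d) ⊆ E.edgeArc s(p, a) ∧
      ∃ ψ : ℂ → ℝ, ContinuousAt ψ (E.pt p) ∧
        IsAngleOff (E.drawing (insert p (insert a Z))) (E.pt p) (E.pt p)
          (fun x => ((E.pt p + d - x) / (E.pt p - x)).arg + ψ x + q x) := by
  obtain ⟨d, hd, hseg, T, hTS, hT, hpT, φ, hφ⟩ := (E.isComplexArc hpa).exists_initial_segment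
  have hlink : G.LinkedIn (insert a Z) a z₀ :=
    (SimpleGraph.LinkedIn.of_adj haz (Set.mem_insert _ _) (Set.mem_insert_of_mem _ hz)).trans
      ((hZ z hz z₀ hz₀).mono (Set.subset_insert _ _))
  obtain ⟨χ, hχ⟩ := E.exists_isAngleOff_of_linkedIn hlink
  have hpaS : E.edgeArc s(p, a) ⊆ E.drawing (insert p (insert a Z)) :=
    E.edgeArc_subset_drawing (by simp) (by simp)
  refine ⟨d, hd, hseg, fun x => φ x + χ x, ?_, ?_⟩
  · refine ContinuousAt.add (hφ.1.continuousAt (hT.isOpen_compl.mem_nhds hpT))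
      (hχ.1.continuousAt ((E.isClosed_drawing _).isOpen_compl.mem_nhds ?_))
    refine E.pt_notMem_drawing ?_
    rintro (h | h)
    · exact hpa.ne h
    · exact hp h
  · exact ((((isAngleOff_segment _ _).mono (hseg.trans hpaS)).add
      ((hφ.mono (hTS.trans hpaS)).add (hχ.mono (E.drawing_mono (Set.subset_insert _ _)))))).add
      (hq.mono (E.edgeArc_subset_drawing (by simp [hz₀]) (by simp)))

/-- If `d / e` were a positive real, the two initial segments would overlap, and the end of the
shorter one would be a second common point of two edges that share only `p`. -/
theorem direction_mem_slitPlane {p a b : V} (hab : a ≠ b) {d e : ℂ} (hd : d ≠ 0) (he : e ≠ 0)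
    (hda : segment ℝ (E.pt p) (E.pt p + d) ⊆ E.edgeArc s(p, a))
    (heb : segment ℝ (E.pt p) (E.pt p + e) ⊆ E.edgeArc s(p, b)) :
    -(d / e) ∈ Complex.slitPlane := by
  have meet : ∀ x, x ≠ 0 → E.pt p + x ∈ E.edgeArc s(p, a) → E.pt p + x ∉ E.edgeArc s(p, b) := by
    intro x hx h h'
    have hne : s(p, a) ≠ s(p, b) := fun h => hab (Sym2.congr_right.1 h)
    obtain ⟨w, hw, hw', hwx⟩ := E.exists_common_end hne h h'
    have hwp : w = p := by
      rcases Sym2.mem_iff.1 hw with rfl | rfl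
      · rfl
      · rcases Sym2.mem_iff.1 hw' with rfl | rfl
        · rfl
        · exact absurd rfl hab
    rw [hwp] at hwx
    exact hx (by simpa using hwx)
  by_contra hs
  rw [Complex.mem_slitPlane_iff_not_le_zero, not_not, Complex.le_def] at hs
  simp only [Complex.zero_re, Complex.zero_im, Complex.neg_re, Complex.neg_im] at hs
  set r := (d / e).re with hr
  have hde : d = r * e := by
    rw [← div_eq_iff he]
    apply Complex.ext
    · simp [hr]
    · simpa using hs.2
  have hr0 : 0 < r := by
    refine lt_of_le_of_ne (by linarith [hs.1]) fun h => hd ?_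
    rw [hde, ← h]
    simp
  have mem : ∀ {t : ℝ} {f : ℂ}, 0 ≤ t → t ≤ 1 → E.pt p + t * f ∈ segment ℝ (E.pt p) (E.pt p + f) := by
    intro t f ht ht1
    rw [segment_eq_image_lineMap]
    refine ⟨t, ⟨ht, ht1⟩, ?_⟩
    simp [AffineMap.lineMap_apply, add_comm]
  rcases le_total r 1 with h | h
  · refine meet d hd (hda (right_mem_segment _ _ _)) (heb ?_)
    rw [hde]
    exact mem hr0.le h
  · refine meet e he (hda ?_) (heb (right_mem_segment _ _ _))
    have : e = (r⁻¹ : ℝ) * d := by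
      rw [hde]
      have : (r : ℂ) ≠ 0 := by exact_mod_cast hr0.ne'
      push_cast
      field_simp
    nth_rw 1 [this]
    exact mem (by positivity) (inv_le_one_of_one_le₀ h)

/-- In a plane graph, let `Z` be connected and let `p`, `a`, `b`, `c` outside of `Z` all have
neighbours in `Z`. If `p` is adjacent to `a`, `b` and `c`, then two of these three are separated
by `p` and the third one. -/
theorem not_linkedIn [Finite V] (E : PlaneEmbedding G) {Z U : Set V} (hUZ : Disjoint U Z)
    (hZ : ∀ u ∈ Z, ∀ v ∈ Z, G.LinkedIn Z u v) {p a b c : V} (hp : p ∈ U) (ha : a ∈ U) (hb : b ∈ U)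
    (hc : c ∈ U) (hab : a ≠ b) (hbc : b ≠ c) (hca : c ≠ a) (hpa : G.Adj p a) (hpb : G.Adj p b)
    (hpc : G.Adj p c) (hpZ : ∃ z ∈ Z, G.Adj p z) (haZ : ∃ z ∈ Z, G.Adj a z)
    (hbZ : ∃ z ∈ Z, G.Adj b z) (hcZ : ∃ z ∈ Z, G.Adj c z) (h₁ : G.LinkedIn (U \ {p, a}) b c)
    (h₂ : G.LinkedIn (U \ {p, b}) c a) (h₃ : G.LinkedIn (U \ {p, c}) a b) : False := by
  obtain ⟨z₀, hz₀, hpz₀⟩ := hpZ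
  obtain ⟨z₁, hz₁, haz⟩ := haZ
  obtain ⟨z₂, hz₂, hbz⟩ := hbZ
  obtain ⟨z₃, hz₃, hcz⟩ := hcZ
  have hUZ' : ∀ {w}, w ∈ U → w ∉ Z := fun hw => Set.disjoint_left.1 hUZ hw
  obtain ⟨q, hq⟩ := (E.isComplexArc hpz₀.symm).exists_isAngleOff
  obtain ⟨d₁, hd₁, hs₁, ψ₁, hψ₁, hΘ₁⟩ :=
    E.exists_closed_angle hZ (hUZ' hp) hpa hz₁ haz hz₀ hq
  obtain ⟨d₂, hd₂, hs₂, ψ₂, hψ₂, hΘ₂⟩ :=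
    E.exists_closed_angle hZ (hUZ' hp) hpb hz₂ hbz hz₀ hq
  obtain ⟨d₃, hd₃, hs₃, ψ₃, hψ₃, hΘ₃⟩ :=
    E.exists_closed_angle hZ (hUZ' hp) hpc hz₃ hcz hz₀ hq
  have dis : ∀ w, Disjoint (U \ {p, w}) (insert p (insert w Z)) := by
    intro w
    rw [Set.disjoint_left]
    rintro x ⟨hxU, hx⟩ (rfl | rfl | hxZ)
    · simp at hx
    · simp at hx
    · exact hUZ' hxU hxZ
  have mem : ∀ {d : ℂ} {w : V} {ε : ℝ}, d ≠ 0 →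
      segment ℝ (E.pt p) (E.pt p + d) ⊆ E.edgeArc s(p, w) → 0 < ε → ε ≤ 1 →
      E.pt p + ε * d ∈ E.edgeArc s(p, w) \ {E.pt p} := by
    intro d w ε hd hs hε hε1
    refine ⟨hs ?_, ?_⟩
    · rw [segment_eq_image_lineMap]
      exact ⟨ε, ⟨hε.le, hε1⟩, by simp [AffineMap.lineMap_apply, add_comm]⟩
    · simp [hd, hε.ne']
  have memU : ∀ {x w : V}, x ∈ U → G.Adj p x → x ≠ w → x ∈ U \ {p, w} := by
    intro x w hx hpx hxw
    exact ⟨hx, by simp [hpx.ne', hxw]⟩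
  refine angle_contradiction (E.direction_mem_slitPlane hab hd₁ hd₂ hs₁ hs₂)
    (E.direction_mem_slitPlane hbc hd₂ hd₃ hs₂ hs₃) (E.direction_mem_slitPlane hca hd₃ hd₁ hs₃ hs₁)
    hψ₁ hψ₂ hψ₃ (q := q)
    (Θ := fun d ψ x => ((E.pt p + d - x) / (E.pt p - x)).arg + ψ x + q x) (fun _ _ _ => rfl)
    ?_ ?_ ?_
  · intro ε hε hε1
    exact E.angle_eq_of_linkedIn (dis a) (memU hc hpc hca) (memU hb hpb hab.symm) hpc hpb h₁.symm
      hΘ₁ (mem hd₃ hs₃ hε hε1) (mem hd₂ hs₂ hε hε1)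
  · intro ε hε hε1
    exact E.angle_eq_of_linkedIn (dis b) (memU ha hpa hab) (memU hc hpc hbc.symm) hpa hpc h₂.symm
      hΘ₂ (mem hd₁ hs₁ hε hε1) (mem hd₃ hs₃ hε hε1)
  · intro ε hε hε1
    exact E.angle_eq_of_linkedIn (dis c) (memU hb hpb hbc) (memU ha hpa hca.symm) hpb hpa h₃.symm
      hΘ₃ (mem hd₂ hs₂ hε hε1) (mem hd₁ hs₁ hε hε1)

end PlaneEmbedding

/-- Let `Z` be connected and let `p`, `a`, `b`, `c` outside of `Z` all have neighbours in `Z`.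
If `p` is adjacent to `a`, `b` and `c`, then two of these three are separated in `U` by `p` and the
third one. -/
def SimpleGraph.SeparatesTriples {V : Type*} (G : SimpleGraph V) : Prop :=
  ∀ Z U : Set V, Disjoint U Z → (∀ u ∈ Z, ∀ v ∈ Z, G.LinkedIn Z u v) →
    ∀ p ∈ U, ∀ a ∈ U, ∀ b ∈ U, ∀ c ∈ U, a ≠ b → b ≠ c → c ≠ a →
    G.Adj p a → G.Adj p b → G.Adj p c → (∃ z ∈ Z, G.Adj p z) → (∃ z ∈ Z, G.Adj a z) →
    (∃ z ∈ Z, G.Adj b z) → (∃ z ∈ Z, G.Adj c z) → G.LinkedIn (U \ {p, a}) b c →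
    G.LinkedIn (U \ {p, b}) c a → ¬ G.LinkedIn (U \ {p, c}) a b

theorem PlaneEmbedding.separatesTriples {V : Type*} [Finite V] {G : SimpleGraph V}
    (E : PlaneEmbedding G) : G.SeparatesTriples :=
  fun _ _ hUZ hZ _ hp _ ha _ hb _ hc hab hbc hca hpa hpb hpc hpZ haZ hbZ hcZ h₁ h₂ h₃ =>
    E.not_linkedIn hUZ hZ hp ha hb hc hab hbc hca hpa hpb hpc hpZ haZ hbZ hcZ h₁ h₂ h₃

theorem Int.eq_units_mul_comm {a b : ℤ} (s : ℤˣ) : a = s * b ↔ b = s * a := by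
  rcases Int.units_eq_one_or s with rfl | rfl
  · simp [eq_comm]
  · simp only [Units.val_neg, Units.val_one]
    constructor <;> intro h <;> linarith

/-! ### List coloring of signed graphs. -/

section ListColoring

variable {V : Type*} {G : SimpleGraph V} {τ : V → V → ℤˣ} {U Z X : Finset V} {L : V → Finset ℤ}
  {c₀ c : V → ℤ}

/-- The assumptions for list coloring the vertices of `U` with signs `τ`, where the vertices of
`X` are colored by `c₀` and the vertices with a neighbour in the connected set `Z` may have shorter
lists. -/
structure IsListInstance (G : SimpleGraph V) (τ : V → V → ℤˣ) (U Z X : Finset V)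
    (L : V → Finset ℤ) (c₀ : V → ℤ) : Prop where
  disjoint : Disjoint U Z
  linked : ∀ u ∈ Z, ∀ v ∈ Z, G.LinkedIn (Z : Set V) u v
  subset : X ⊆ U
  exists_adj : ∀ x ∈ X, ∃ z ∈ Z, G.Adj x z
  clique : ∀ x ∈ X, ∀ y ∈ X, x ≠ y → G.Adj x y
  card_le : #X ≤ 2
  proper : ∀ x ∈ X, ∀ y ∈ X, G.Adj x y → c₀ x ≠ τ x y * c₀ y
  three_le : ∀ u ∈ U, u ∉ X → 3 ≤ #(L u)
  five_le : ∀ u ∈ U, (∀ z ∈ Z, ¬ G.Adj u z) → 5 ≤ #(L u)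

/-- `c` is a proper coloring of `U` from the lists `L` that extends `c₀` on `X`. -/
structure IsListColoring (G : SimpleGraph V) (τ : V → V → ℤˣ) (U X : Finset V)
    (L : V → Finset ℤ) (c₀ c : V → ℤ) : Prop where
  eq : ∀ x ∈ X, c x = c₀ x
  mem : ∀ u ∈ U, u ∉ X → c u ∈ L u
  proper : ∀ u ∈ U, ∀ v ∈ U, G.Adj u v → c u ≠ τ u v * c v

/-- Every instance that is smaller than one with sets `U` and `X` has a coloring. -/
def SmallerColorable (G : SimpleGraph V) (τ : V → V → ℤˣ) (U X : Finset V) : Prop :=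
  ∀ (U' Z' X' : Finset V) (L' : V → Finset ℤ) (c₀' : V → ℤ), IsListInstance G τ U' Z' X' L' c₀' →
    3 * #U' + #X < 3 * #U + #X' → ∃ c, IsListColoring G τ U' X' L' c₀' c

variable [DecidableEq V]

/-- Color the side containing `X`, then the other side with the overlap as its precolored clique. -/
theorem IsListInstance.glue (h : IsListInstance G τ U Z X L c₀) (ih : SmallerColorable G τ U X)
    {U₁ U₂ : Finset V} (h₁ : U₁ ⊂ U) (h₂ : U₂ ⊂ U) (hU : U ⊆ U₁ ∪ U₂) (hX : X ⊆ U₁)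
    (hS : ∀ x ∈ U₁ ∩ U₂, ∃ z ∈ Z, G.Adj x z)
    (hclique : ∀ x ∈ U₁ ∩ U₂, ∀ y ∈ U₁ ∩ U₂, x ≠ y → G.Adj x y) (hcard : #(U₁ ∩ U₂) ≤ 2)
    (hadj : ∀ u ∈ U₁, ∀ v ∈ U₂, G.Adj u v → u ∈ U₂ ∨ v ∈ U₁) :
    ∃ c, IsListColoring G τ U X L c₀ c := by
  have hc₁ := card_lt_card h₁
  have hc₂ := card_lt_card h₂
  have hXc := h.card_le
  obtain ⟨c₁, hc₁⟩ := ih U₁ Z X L c₀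
    { h with
      disjoint := h.disjoint.mono_left h₁.1
      subset := hX
      three_le := fun u hu => h.three_le u (h₁.1 hu)
      five_le := fun u hu => h.five_le u (h₁.1 hu) } (by omega)
  -- The precolored set may shrink by as much as two; the weight 3 of the vertex lost from `U`
  -- outweighs this.
  obtain ⟨c₂, hc₂⟩ := ih U₂ Z (U₁ ∩ U₂) L c₁
    { disjoint := h.disjoint.mono_left h₂.1
      linked := h.linked
      subset := inter_subset_right
      exists_adj := hS
      clique := hclique
      card_le := hcard
      proper := fun x hx y hy =>
        hc₁.proper x (mem_of_mem_inter_left hx) y (mem_of_mem_inter_left hy)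
      three_le := fun u hu huS => h.three_le u (h₂.1 hu) fun huX =>
        huS (mem_inter.2 ⟨hX huX, hu⟩)
      five_le := fun u hu => h.five_le u (h₂.1 hu) } (by omega)
  let c : V → ℤ := fun v => if v ∈ U₁ then c₁ v else c₂ v
  have e₁ : ∀ v ∈ U₁, c v = c₁ v := fun v hv => if_pos hv
  have e₂ : ∀ v ∈ U₂, c v = c₂ v := by
    intro v hv
    by_cases hv₁ : v ∈ U₁
    · rw [e₁ v hv₁, hc₂.eq v (mem_inter.2 ⟨hv₁, hv⟩)]
    · exact if_neg hv₁
  refine ⟨c, fun x hx => by rw [e₁ x (hX hx), hc₁.eq x hx], fun u hu huX => ?_,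
    fun u hu v hv huv => ?_⟩
  · by_cases hu₁ : u ∈ U₁
    · rw [e₁ u hu₁]
      exact hc₁.mem u hu₁ huX
    · have hu₂ := (mem_union.1 (hU hu)).resolve_left hu₁
      rw [e₂ u hu₂]
      exact hc₂.mem u hu₂ fun h' => hu₁ (mem_of_mem_inter_left h')
  · have both : (u ∈ U₁ ∧ v ∈ U₁) ∨ (u ∈ U₂ ∧ v ∈ U₂) := by
      rcases mem_union.1 (hU hu) with hu' | hu' <;> rcases mem_union.1 (hU hv) with hv' | hv'
      · exact Or.inl ⟨hu', hv'⟩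
      · exact (hadj u hu' v hv' huv).elim (fun h => Or.inr ⟨h, hv'⟩) fun h => Or.inl ⟨hu', h⟩
      · exact (hadj v hv' u hu' huv.symm).elim (fun h => Or.inr ⟨hu', h⟩)
          fun h => Or.inl ⟨h, hv'⟩
      · exact Or.inr ⟨hu', hv'⟩
    rcases both with ⟨hu', hv'⟩ | ⟨hu', hv'⟩
    · rw [e₁ u hu', e₁ v hv']
      exact hc₁.proper u hu' v hv' huv
    · rw [e₂ u hu', e₂ v hv']
      exact hc₂.proper u hu' v hv' huv

/-- The component `K` of `b` together with `p`, `a`, and the complement of `K`, overlap exactly in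
the edge `pa`. Both its ends see `Z`, so it may serve as a precolored clique. -/
theorem IsListInstance.glue_of_not_linkedIn (h : IsListInstance G τ U Z X L c₀)
    (ih : SmallerColorable G τ U X) {p a b c : V} (hp : p ∈ U) (ha : a ∈ U) (hb : b ∈ U)
    (hc : c ∈ U) (hpa : G.Adj p a) (hbp : b ≠ p) (hba : b ≠ a) (hcp : c ≠ p) (hca : c ≠ a)
    (hpZ : ∃ z ∈ Z, G.Adj p z) (haZ : ∃ z ∈ Z, G.Adj a z)
    (hbc : ¬ G.LinkedIn ((U : Set V) \ {p, a}) b c) :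
    ∃ c, IsListColoring G τ U X L c₀ c := by
  classical
  let R : Set V := (U : Set V) \ {p, a}
  let K : Finset V := {u ∈ U | u ≠ p ∧ u ≠ a ∧ G.LinkedIn R b u}
  have hK : ∀ {u}, u ∈ K ↔ u ∈ U ∧ u ≠ p ∧ u ≠ a ∧ G.LinkedIn R b u := by
    intro u
    simp [K]
  have hKR : ∀ {u v}, u ∈ K → v ∈ U → G.Adj u v → v ∈ K ∪ {p, a} := by
    intro u v hu hv huv
    by_cases hvp : v = p
    · simp [hvp]
    by_cases hva : v = a
    · simp [hva]
    obtain ⟨huU, hup, hua, hbu⟩ := hK.1 hu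
    refine mem_union_left _ (hK.2 ⟨hv, hvp, hva, hbu.trans (.of_adj huv ?_ ?_)⟩)
    · exact ⟨huU, by simp [hup, hua]⟩
    · exact ⟨hv, by simp [hvp, hva]⟩
  have hbK : b ∈ K := hK.2 ⟨hb, hbp, hba, .refl⟩
  have hcK : c ∉ K := fun h => hbc (hK.1 h).2.2.2
  have hKU : K ⊆ U := filter_subset _ _
  have hinter : ∀ x, x ∈ (K ∪ {p, a}) ∩ (U \ K) ↔ x = p ∨ x = a := by
    intro x
    simp only [mem_inter, mem_union, mem_insert, mem_singleton, Finset.mem_sdiff]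
    constructor
    · rintro ⟨h1 | h1, -, h2⟩
      · exact absurd h1 h2
      · exact h1
    · rintro (rfl | rfl)
      · exact ⟨Or.inr (Or.inl rfl), hp, fun h => (hK.1 h).2.1 rfl⟩
      · exact ⟨Or.inr (Or.inr rfl), ha, fun h => (hK.1 h).2.2.1 rfl⟩
  have hinter' : (K ∪ {p, a}) ∩ (U \ K) = {p, a} := by
    ext x
    rw [hinter]
    simp
  have hs₁ : K ∪ {p, a} ⊂ U := by
    refine ⟨union_subset hKU (by simp [insert_subset_iff, hp, ha]), fun h => ?_⟩
    have := h hc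
    simp [hcK, hcp, hca] at this
  have hs₂ : U \ K ⊂ U := ⟨sdiff_subset, fun h => (Finset.mem_sdiff.1 (h hb)).2 hbK⟩
  have hS : ∀ x, x = p ∨ x = a → ∃ z ∈ Z, G.Adj x z := by
    rintro x (rfl | rfl) <;> assumption
  have hcl : ∀ x y, (x = p ∨ x = a) → (y = p ∨ y = a) → x ≠ y → G.Adj x y := by
    rintro x y (rfl | rfl) (rfl | rfl) hxy
    · exact absurd rfl hxy
    · exact hpa
    · exact hpa.symm
    · exact absurd rfl hxy
  have hcard : #((K ∪ {p, a}) ∩ (U \ K)) ≤ 2 := by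
    rw [hinter']
    exact card_le_two
  -- No edge leaves `K` except to `p` and `a`, so the clique `X` lies on one side, which is to be
  -- colored first.
  by_cases hXK : ∃ x ∈ X, x ∈ K
  · obtain ⟨x, hxX, hxK⟩ := hXK
    refine h.glue ih hs₁ hs₂ ?_ ?_ (fun x hx => hS x ((hinter x).1 hx))
      (fun x hx y hy => hcl x y ((hinter x).1 hx) ((hinter y).1 hy)) hcard ?_
    · intro u hu
      by_cases huK : u ∈ K <;> simp [huK, hu]
    · intro y hy
      by_cases hxy : x = y
      · exact mem_union_left _ (hxy ▸ hxK)
      · exact hKR hxK (h.subset hy) (h.clique x hxX y hy hxy)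
    · intro u hu v hv huv
      by_cases huK : u ∈ K
      · exact Or.inr (hKR huK (Finset.mem_sdiff.1 hv).1 huv)
      · exact Or.inl (Finset.mem_sdiff.2 ⟨hs₁.1 hu, huK⟩)
  · push Not at hXK
    rw [inter_comm] at hcard
    refine h.glue ih hs₂ hs₁ ?_ (fun x hx => Finset.mem_sdiff.2 ⟨h.subset hx, hXK x hx⟩)
      (fun x hx => hS x ((hinter x).1 (inter_comm _ (U \ K) ▸ hx)))
      (fun x hx y hy => hcl x y ((hinter x).1 (inter_comm _ (U \ K) ▸ hx))
        ((hinter y).1 (inter_comm _ (U \ K) ▸ hy))) hcard ?_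
    · intro u hu
      by_cases huK : u ∈ K <;> simp [huK, hu]
    · intro u hu v hv huv
      by_cases hvK : v ∈ K
      · exact Or.inl (hKR hvK (Finset.mem_sdiff.1 hu).1 huv.symm)
      · exact Or.inr (Finset.mem_sdiff.2 ⟨hs₁.1 hv, hvK⟩)

/-- Move the vertex `v` from `U` to `Z`, and remove at most two of its colors from the lists of
those neighbours that had none in `Z`. -/
theorem IsListInstance.exists_coloring_erase (h : IsListInstance G τ U Z X L c₀)
    (ih : SmallerColorable G τ U X) {v : V} (hv : v ∈ U) (hvZ : Z = ∅ ∨ ∃ z ∈ Z, G.Adj v z)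
    {R : Finset ℤ} (hR : #R ≤ 2) :
    ∃ c, IsListColoring G τ (U.erase v) (X.erase v) L c₀ c ∧
      ∀ u ∈ U, G.Adj u v → (∀ z ∈ Z, ¬ G.Adj u z) → ∀ r ∈ R, c u ≠ τ u v * r := by
  classical
  let L' : V → Finset ℤ := fun u =>
    if G.Adj u v ∧ ∀ z ∈ Z, ¬ G.Adj u z then L u \ R.image (fun r => τ u v * r) else L u
  have hsub : ∀ u, L' u ⊆ L u := by
    intro u
    simp only [L']
    split_ifs
    · exact sdiff_subset
    · exact Subset.refl _
  have hXc := pred_card_le_card_erase (s := X) (a := v)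
  have hUc := card_erase_of_mem hv
  have hUp := card_pos.2 ⟨v, hv⟩
  obtain ⟨c, hc⟩ := ih (U.erase v) (insert v Z) (X.erase v) L' c₀
    { disjoint := by
        rw [disjoint_insert_right]
        exact ⟨notMem_erase v U, h.disjoint.mono_left (erase_subset _ _)⟩
      linked := by
        have toV : ∀ u ∈ insert v Z, G.LinkedIn (↑(insert v Z) : Set V) v u := by
          intro u hu
          rcases mem_insert.1 hu with rfl | hu
          · exact .refl
          · rcases hvZ with rfl | ⟨z, hz, hvz⟩
            · simp at hu
            · exact (SimpleGraph.LinkedIn.of_adj hvz (by simp) (by simp [hz])).trans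
                ((h.linked z hz u hu).mono (by simp))
        exact fun u hu w hw => (toV u hu).symm.trans (toV w hw)
      subset := erase_subset_erase _ h.subset
      exists_adj := fun x hx => by
        obtain ⟨z, hz, hxz⟩ := h.exists_adj x (mem_of_mem_erase hx)
        exact ⟨z, mem_insert_of_mem hz, hxz⟩
      clique := fun x hx y hy => h.clique x (mem_of_mem_erase hx) y (mem_of_mem_erase hy)
      card_le := (card_erase_le).trans h.card_le
      proper := fun x hx y hy => h.proper x (mem_of_mem_erase hx) y (mem_of_mem_erase hy)
      three_le := fun u hu huX => by
        have huU := mem_of_mem_erase hu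
        have huX' : u ∉ X := fun h' => huX (mem_erase.2 ⟨ne_of_mem_erase hu, h'⟩)
        simp only [L']
        split_ifs with hcond
        · have h5 := h.five_le u huU hcond.2
          have := le_card_sdiff (R.image fun r => (τ u v : ℤ) * r) (L u)
          have : #(R.image fun r => (τ u v : ℤ) * r) ≤ #R := card_image_le
          omega
        · exact h.three_le u huU huX'
      five_le := fun u hu hadj => by
        have hnv : ¬ G.Adj u v := hadj v (mem_insert_self _ _)
        simp only [L', hnv, false_and, if_false]
        exact h.five_le u (mem_of_mem_erase hu) fun z hz => hadj z (mem_insert_of_mem hz) }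
    (by omega)
  refine ⟨c, ⟨hc.eq, fun u hu huX => hsub u (hc.mem u hu huX), hc.proper⟩, ?_⟩
  intro u hu huv huZ r hr heq
  have huX : u ∉ X.erase v := fun h' => by
    obtain ⟨z, hz, huz⟩ := h.exists_adj u (mem_of_mem_erase h')
    exact huZ z hz huz
  have := hc.mem u (mem_erase.2 ⟨huv.ne, hu⟩) huX
  simp only [L', if_pos (And.intro huv huZ), Finset.mem_sdiff] at this
  exact this.2 (mem_image.2 ⟨r, hr, heq.symm⟩)

theorem IsListColoring.update (hτ : ∀ u v, τ u v = τ v u) {v : V} {α : ℤ}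
    (h : IsListColoring G τ (U.erase v) (X.erase v) L c₀ c) (hX : v ∈ X → α = c₀ v)
    (hL : v ∉ X → α ∈ L v) (hα : ∀ u ∈ U, G.Adj u v → c u ≠ τ u v * α) :
    IsListColoring G τ U X L c₀ (Function.update c v α) := by
  refine ⟨fun x hx => ?_, fun u hu huX => ?_, fun u hu w hw huw => ?_⟩
  · by_cases hxv : x = v
    · subst hxv
      simpa using hX hx
    · simpa [hxv] using h.eq x (mem_erase.2 ⟨hxv, hx⟩)
  · by_cases huv : u = v
    · subst huv
      simpa using hL huX
    · simpa [huv] using h.mem u (mem_erase.2 ⟨huv, hu⟩) fun h' => huX (mem_of_mem_erase h')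
  · by_cases huv : u = v
    · subst huv
      have := hα w hw huw.symm
      rw [Function.update_self, Function.update_of_ne huw.ne', Ne, Int.eq_units_mul_comm, hτ]
      exact this
    · by_cases hwv : w = v
      · subst hwv
        rw [Function.update_self, Function.update_of_ne huv]
        exact hα u hu huw
      · rw [Function.update_of_ne huv, Function.update_of_ne hwv]
        exact h.proper u (mem_erase.2 ⟨huv, hu⟩) w (mem_erase.2 ⟨hwv, hw⟩) huw

/-- The list coloring theorem of Thomassen, for signed graphs. -/
theorem IsListInstance.exists_coloring (hG : G.SeparatesTriples) (hτ : ∀ u v, τ u v = τ v u)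
    (h : IsListInstance G τ U Z X L c₀) : ∃ c, IsListColoring G τ U X L c₀ c := by
  classical
  -- This measure drops when a vertex is deleted, even one of `X`, and also when a vertex is merely
  -- added to `X`.
  induction hn : 3 * #U - #X using Nat.strong_induction_on generalizing U Z X L c₀ with
  | _ n IH =>
  have ih : SmallerColorable G τ U X := by
    intro U' Z' X' L' c₀' h' hlt
    have := card_le_card h'.subset
    have := card_le_card h.subset
    exact IH _ (by omega) h' rfl
  clear IH hn
  rcases X.eq_empty_or_nonempty with rfl | ⟨x, hx⟩
  · by_cases hB : ∃ v ∈ U, ∃ z ∈ Z, G.Adj v z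
    · obtain ⟨v, hv, hvZ⟩ := hB
      obtain ⟨α, hα⟩ : (L v).Nonempty :=
        card_pos.1 (by have := h.three_le v hv (notMem_empty v); omega)
      obtain ⟨c, hc⟩ := ih U Z {v} L (fun _ => α)
        { disjoint := h.disjoint
          linked := h.linked
          subset := by simpa using hv
          exists_adj := by simpa using hvZ
          clique := by simp
          card_le := by simp
          proper := by simp
          three_le := fun u hu _ => h.three_le u hu (notMem_empty u)
          five_le := h.five_le } (by simp)
      refine ⟨c, by simp, fun u hu _ => ?_, hc.proper⟩
      by_cases huv : u = v
      · subst huv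
        rw [hc.eq u (by simp)]
        exact hα
      · exact hc.mem u hu (by simpa using huv)
    · push Not at hB
      rcases U.eq_empty_or_nonempty with rfl | ⟨v, hv⟩
      · exact ⟨c₀, by simp, by simp, by simp⟩
      obtain ⟨α, hα⟩ : (L v).Nonempty :=
        card_pos.1 (by have := h.three_le v hv (notMem_empty v); omega)
      -- No vertex sees `Z`, so `Z` is discarded and the deleted vertex `v` alone forms the new
      -- connected set.
      have h' : IsListInstance G τ U ∅ ∅ L c₀ :=
        { h with
          disjoint := disjoint_empty_right U
          linked := by simp
          exists_adj := by simp
          five_le := fun u hu _ => h.five_le u hu (hB u hu) }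
      obtain ⟨c, hc, hcR⟩ := h'.exists_coloring_erase ih hv (Or.inl rfl) (R := {α}) (by simp)
      exact ⟨_, hc.update hτ (by simp) (fun _ => hα)
        fun u hu huv => hcR u hu huv (by simp) α (by simp)⟩
  by_cases hv : ∃ v ∈ U, v ∉ X ∧ G.Adj v x ∧ ∃ z ∈ Z, G.Adj v z
  · obtain ⟨v, hv, hvX, hvx, hvZ⟩ := hv
    let N : Finset V := {u ∈ U | G.Adj v u ∧ ∃ z ∈ Z, G.Adj u z}
    -- Three boundary neighbours of `v` give an edge at `v` that separates, the analogue of a chord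
    -- in Thomassen's proof.
    by_cases hN : 2 < #N
    · obtain ⟨a, ha, b, hb, c, hc, hab, hac, hbc⟩ := two_lt_card.1 hN
      obtain ⟨haU, hva, haZ⟩ := mem_filter.1 ha
      obtain ⟨hbU, hvb, hbZ⟩ := mem_filter.1 hb
      obtain ⟨hcU, hvc, hcZ⟩ := mem_filter.1 hc
      by_cases h₁ : G.LinkedIn ((U : Set V) \ {v, a}) b c
      · by_cases h₂ : G.LinkedIn ((U : Set V) \ {v, b}) c a
        · have h₃ := hG Z U (by exact_mod_cast h.disjoint) h.linked v hv a haU b hbU c hcU hab hbc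
            hac.symm hva hvb hvc hvZ haZ hbZ hcZ h₁ h₂
          exact h.glue_of_not_linkedIn ih hv hcU haU hbU hvc hva.ne' hac hvb.ne' hbc hvZ hcZ h₃
        · exact h.glue_of_not_linkedIn ih hv hbU hcU haU hvb hvc.ne' hbc.symm hva.ne' hab hvZ hbZ h₂
      · exact h.glue_of_not_linkedIn ih hv haU hbU hcU hva hvb.ne' hab.symm hvc.ne' hac.symm
          hvZ haZ h₁
    -- Two colors compatible with `x` are reserved for `v` and barred, up to sign, from its inner
    -- neighbours. Besides `x` at most one boundary neighbour remains, and it spoils at most one of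
    -- the two.
    · obtain ⟨R, hRL, hR⟩ : ∃ R ⊆ (L v).erase (τ v x * c₀ x), #R = 2 := by
        apply exists_subset_card_eq
        have := h.three_le v hv hvX
        have := pred_card_le_card_erase (s := L v) (a := τ v x * c₀ x)
        omega
      obtain ⟨c, hc, hcR⟩ := h.exists_coloring_erase ih hv (Or.inr hvZ) hR.le
      have hxN : x ∈ N := mem_filter.2 ⟨h.subset hx, hvx, h.exists_adj x hx⟩
      obtain ⟨α, hα⟩ : (R \ (N.erase x).image fun u => (τ v u : ℤ) * c u).Nonempty := by
        apply card_pos.1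
        have := le_card_sdiff ((N.erase x).image fun u => (τ v u : ℤ) * c u) R
        have : #((N.erase x).image fun u => (τ v u : ℤ) * c u) ≤ #(N.erase x) := card_image_le
        have := card_erase_of_mem hxN
        omega
      obtain ⟨hαR, hαN⟩ := Finset.mem_sdiff.1 hα
      obtain ⟨hαx, hαL⟩ := mem_erase.1 (hRL hαR)
      refine ⟨_, hc.update hτ (fun h' => absurd h' hvX) (fun _ => hαL) fun u hu huv => ?_⟩
      by_cases huZ : ∃ z ∈ Z, G.Adj u z
      · rw [Ne, Int.eq_units_mul_comm, hτ]
        by_cases hux : u = x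
        · subst hux
          rwa [hc.eq u (mem_erase.2 ⟨huv.ne, hx⟩)]
        · intro heq
          exact hαN (mem_image.2 ⟨u, mem_erase.2 ⟨hux, mem_filter.2 ⟨hu, huv.symm, huZ⟩⟩, heq.symm⟩)
      · push Not at huZ
        exact hcR u hu huv huZ α hαR
  -- Now every boundary neighbour of `x` is precolored, so `x` can be deleted once its color is
  -- barred from its inner neighbours.
  · push Not at hv
    obtain ⟨c, hc, hcR⟩ := h.exists_coloring_erase ih (h.subset hx) (Or.inr (h.exists_adj x hx))
      (R := {c₀ x}) (by simp)
    refine ⟨_, hc.update hτ (fun _ => rfl) (fun h' => absurd hx h') fun u hu hux => ?_⟩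
    by_cases huZ : ∀ z ∈ Z, ¬ G.Adj u z
    · exact hcR u hu hux huZ _ (by simp)
    · have huX : u ∈ X := by
        by_contra huX
        exact huZ (hv u hu huX hux)
      rw [hc.eq u (mem_erase.2 ⟨hux.ne, huX⟩)]
      exact h.proper u huX x hx hux

end ListColoring

/-! ### The signed five-color theorem. -/

/-- With `Z` and `X` empty, every list may be the same palette; any five integers do, as the
argument never uses symmetry under negation. -/
theorem SignedGraph.colorableIn_of_isPlanar {V : Type*} [Finite V] (S : SignedGraph V)
    (hS : S.IsPlanar) (P : Finset ℤ) (hP : 5 ≤ #P) : S.ColorableIn P := by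
  classical
  have := Fintype.ofFinite V
  obtain ⟨E⟩ := hS
  -- The value `1` off the edge set is arbitrary, since properness only concerns adjacent pairs.
  let sgn : Sym2 V → ℤˣ := fun e => if h : e ∈ S.graph.edgeSet then S.sign ⟨e, h⟩ else 1
  have inst : IsListInstance S.graph (fun u v => sgn s(u, v)) univ ∅ ∅ (fun _ => P) fun _ => 0 :=
    { disjoint := disjoint_empty_right _
      linked := by simp
      subset := empty_subset _
      exists_adj := by simp
      clique := by simp
      card_le := by simp
      proper := by simp
      three_le := fun _ _ _ => by omega
      five_le := fun _ _ _ => hP }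
  obtain ⟨c, hc⟩ := inst.exists_coloring E.separatesTriples fun u v => by rw [Sym2.eq_swap]
  refine ⟨c, fun u v huv => ?_, fun v => hc.mem v (mem_univ v) (notMem_empty v)⟩
  have := hc.proper u (mem_univ u) v (mem_univ v) huv
  simpa only [sgn, dif_pos (S.graph.mem_edgeSet.2 huv)] using this

theorem mainTheorem4 {V : Type*} [Finite V] (S : SignedGraph V) (hS : S.IsPlanar) :
    S.ColorableIn ({-2, -1, 0, 1, 2} : Set ℤ) ∧
      S.chromaticNumber ≤ 5 ∧ S.mrsChromaticNumber ≤ 5 := by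
  obtain ⟨c, hc, hcP⟩ := S.colorableIn_of_isPlanar hS {-2, -1, 0, 1, 2} (by decide)
  simp only [coe_insert, coe_singleton, Set.mem_insert_iff, Set.mem_singleton_iff] at hcP
  refine ⟨⟨c, hc, hcP⟩, ?_, ?_⟩
  · refine (iInf₂_le 2 ⟨c, hc, fun v => ?_⟩).trans (by norm_num)
    rcases hcP v with h | h | h | h | h <;> rw [h] <;> simp [SignedGraph.symmPalette]
  · refine (iInf₂_le 5 ⟨c, hc, fun v => ?_⟩).trans (by norm_num)
    rcases hcP v with h | h | h | h | h <;> rw [h] <;>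
      simp [SignedGraph.mrsPalette, show Odd 5 by decide]
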